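/- Let $\mathbb{H}$ be the quaternions and $\mathbb{B}=\{q\in\mathbb{H}:|q|<1\}$. A function $f:\mathbb{B}\to\mathbb{H}$ is called regular if, for every $I\in\mathbb{H}$ with $I^2=-1$, its restriction to $\mathbb{B}\cap(\mathbb{R}+I\mathbb{R})$ is real differentiable and $\frac12\left(\frac{\partial}{\partial x}+I\frac{\partial}{\partial y}\right)f(x+Iy)=0$ there. Its Cullen derivative is $\partial_c f(x+Iy)=\frac12\left(\frac{\partial}{\partial x}-I\frac{\partial}{\partial y}\right)f(x+Iy)$, and $\partial_c^m$ denotes the $m$-th iterate of $\partial_c$. Regular functions on $\mathbb{B}$ are the sums $f(q)=\sum_{k} q^k a_k$ of power series converging in $\mathbb{B}$, with $a_k\in\mathbb{H}$; for $f=\sum_k q^ka_k$ and $g=\sum_k q^kb_k$ put $$f*g(q)=\sum_{k}q^k\sum_{j=0}^k a_jb_{k-j},\qquad f^c(q)=\sum_k q^k\overline{a_k},\qquad f^s=f*f^c,$$ $$g*f^{-*}(q)=f^s(q)^{-1}\,(g*f^c)(q)\quad\text{where } f^s(q)\neq0.$$ Write $f^{*n}$ for the $*$-product of $n$ copies of $f$,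 and $f^{-*n}=(f^{*n})^{-*}$. A quaternion inside a $*$-product stands for the constant function, and $q$ for the identity function. Theorem. Let $f:\mathbb{B}\to\mathbb{B}$ be regular, let $q_0\in\mathbb{B}$ and let $n\ge1$ be an integer. Suppose that $\partial_c^mf(q_0)=0$ for all $1\le m\le n-1$. Then the symmetrization of $1-\overline{f(q_0)}*f$ has no zeros in $\mathbb{B}$, so that right quotients by $1-\overline{f(q_0)}*f$ are defined on all of $\mathbb{B}$; for all $q\in\mathbb{B}$ $$\left|(f(q)-f(q_0))*(1-\overline{f(q_0)}*f(q))^{-*}\right|\le\left|(q-q_0)^{*n}*(1-\overline{q_0}*q)^{-*n}\right|;$$ and, evaluating at $q_0$, $$\left|\partial_c^nf*(1-\overline{f(q_0)}*f)^{-*}\right|_{|_{q_0}}\le\frac{n!}{(1-|q_0|^2)^n}.$$ -/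

import Mathlib

open scoped Quaternion Nat

noncomputable section

namespace SliceRegular

/-- The open unit ball of the quaternions. -/
def unitBall : Set ℍ[ℝ] := Metric.ball 0 1

/-- (Cullen, or slice) regularity of `f` on an open set `Ω`: for every imaginary unit `I`, the
restriction of `f` to the slice `Ω ∩ (ℝ + I ℝ)` is real differentiable, and
`(1/2) (∂/∂x + I ∂/∂y) f (x + I y)` vanishes there.
The partial derivatives at `x + I y` are the line derivatives in the directions `1` and `I`. -/
def IsRegularOn (f : ℍ[ℝ] → ℍ[ℝ]) (Ω : Set ℍ[ℝ]) : Prop :=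
  ∀ I : ℍ[ℝ], I ^ 2 = -1 → ∀ x y : ℝ, (x : ℍ[ℝ]) + y • I ∈ Ω →
    DifferentiableAt ℝ (fun p : ℝ × ℝ => f ((p.1 : ℍ[ℝ]) + p.2 • I)) (x, y) ∧
    (1 / 2 : ℝ) • (lineDeriv ℝ f ((x : ℍ[ℝ]) + y • I) 1
      + I * lineDeriv ℝ f ((x : ℍ[ℝ]) + y • I) I) = 0

/-- The quaternion `i`. -/
def iUnit : ℍ[ℝ] := ⟨0, 1, 0, 0⟩

/-- An imaginary unit `I` such that `q` lies in `ℝ + I ℝ`: the direction of the imaginary part of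
`q`, or the unit `i` when `q` is real. -/
def imUnit (q : ℍ[ℝ]) : ℍ[ℝ] :=
  open Classical in if q.im = 0 then iUnit else ‖q.im‖⁻¹ • q.im

/-- The Cullen derivative `(1/2) (∂/∂x - I ∂/∂y) f (x + I y)` at `q = x + I y`. For regular
functions it does not depend on the choice of `I` at real points, see `cullenDeriv_eq`. -/
def cullenDeriv (f : ℍ[ℝ] → ℍ[ℝ]) (q : ℍ[ℝ]) : ℍ[ℝ] :=
  (1 / 2 : ℝ) • (lineDeriv ℝ f q 1 - imUnit q * lineDeriv ℝ f q (imUnit q))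

/-- `f` is the sum on the unit ball of the power series `∑ qⁿ aₙ`. -/
def HasSeries (f : ℍ[ℝ] → ℍ[ℝ]) (a : ℕ → ℍ[ℝ]) : Prop :=
  ∀ q ∈ unitBall, HasSum (fun n => q ^ n * a n) (f q)

/-- The coefficients of the power series of `f` on the unit ball (they are unique, see
`HasSeries.coeff_eq`). -/
def coeff (f : ℍ[ℝ] → ℍ[ℝ]) : ℕ → ℍ[ℝ] :=
  open Classical in if h : ∃ a, HasSeries f a then h.choose else 0

/-- Regular multiplication of `f = ∑ qⁿ aₙ` and `g = ∑ qⁿ bₙ`: the power series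
`∑ qⁿ (∑ₖ aₖ bₙ₋ₖ)`. -/
def starMul (f g : ℍ[ℝ] → ℍ[ℝ]) (q : ℍ[ℝ]) : ℍ[ℝ] :=
  ∑' n : ℕ, q ^ n * ∑ k ∈ Finset.range (n + 1), coeff f k * coeff g (n - k)

/-- The `*`-product of `n` copies of `f`. -/
def starPow (f : ℍ[ℝ] → ℍ[ℝ]) : ℕ → ℍ[ℝ] → ℍ[ℝ]
  | 0 => fun _ => 1
  | n + 1 => starMul (starPow f n) f

/-- The regular conjugate `∑ qⁿ (star aₙ)` of `f = ∑ qⁿ aₙ`. -/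
def conj (f : ℍ[ℝ] → ℍ[ℝ]) (q : ℍ[ℝ]) : ℍ[ℝ] :=
  ∑' n : ℕ, q ^ n * star (coeff f n)

/-- The symmetrization `fˢ = f * fᶜ`. -/
def symm (f : ℍ[ℝ] → ℍ[ℝ]) : ℍ[ℝ] → ℍ[ℝ] := starMul f (conj f)

/-- The right regular quotient `g * h⁻*`, with value `hˢ(q)⁻¹ (g * hᶜ)(q)`; it is meaningful off the
zero set of `hˢ`. -/
def starDiv (g h : ℍ[ℝ] → ℍ[ℝ]) (q : ℍ[ℝ]) : ℍ[ℝ] :=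
  (symm h q)⁻¹ * starMul g (conj h) q

/-- The function `q ↦ 1 - a̅ * f(q)`, where `a̅ * f` is the regular product of a constant and `f`. -/
def oneSubStar (a : ℍ[ℝ]) (f : ℍ[ℝ] → ℍ[ℝ]) (q : ℍ[ℝ]) : ℍ[ℝ] :=
  1 - starMul (fun _ => star a) f q

theorem HasSeries.unique {f : ℍ[ℝ] → ℍ[ℝ]} {a b : ℕ → ℍ[ℝ]}
    (ha : HasSeries f a) (hb : HasSeries f b) : a = b := by
  let P : (ℕ → ℍ[ℝ]) → FormalMultilinearSeries ℝ ℝ ℍ[ℝ] := fun c n =>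
    ContinuousMultilinearMap.mkPiRing ℝ (Fin n) (c n)
  have hP : ∀ c n, (P c).coeff n = c n := by
    intro c n
    rw [FormalMultilinearSeries.coeff]
    exact (ContinuousMultilinearMap.mkPiRing_apply _ _).trans (by simp)
  have key : ∀ c : ℕ → ℍ[ℝ], HasSeries f c →
      HasFPowerSeriesAt (fun x : ℝ => f (x : ℍ[ℝ])) (P c) 0 := by
    intro c hc
    refine hasFPowerSeriesAt_iff.mpr ?_
    filter_upwards [Metric.ball_mem_nhds (0 : ℝ) one_pos] with x hx
    have hxb : (x : ℍ[ℝ]) ∈ unitBall := by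
      simpa [unitBall] using hx
    have h := hc _ hxb
    simp only [hP, zero_add]
    have e : (fun n => (x : ℍ[ℝ]) ^ n * c n) = fun n => x ^ n • c n := by
      funext n
      rw [← Quaternion.coe_pow, Quaternion.coe_mul_eq_smul]
    rw [e] at h
    exact h
  have h := (key a ha).eq_formalMultilinearSeries (key b hb)
  funext n
  rw [← hP a n, h, hP]

theorem HasSeries.coeff_eq {f : ℍ[ℝ] → ℍ[ℝ]} {a : ℕ → ℍ[ℝ]} (ha : HasSeries f a) :
    coeff f = a := by
  have h : ∃ a, HasSeries f a := ⟨a, ha⟩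
  rw [coeff, dif_pos h]
  exact h.choose_spec.unique ha

theorem imUnit_sq (q : ℍ[ℝ]) : imUnit q ^ 2 = -1 := by
  by_cases h : q.im = 0
  · have h0 : imUnit q = iUnit := if_pos h
    rw [h0, sq]
    ext <;> simp <;> simp [iUnit]
  · have h0 : imUnit q = ‖q.im‖⁻¹ • q.im := if_neg h
    have h1 : q.im * q.im = -((‖q.im‖ ^ 2 : ℝ) : ℍ[ℝ]) := by
      have h2 := Quaternion.self_mul_star q.im
      rw [Quaternion.normSq_eq_norm_mul_self, Quaternion.star_im, mul_neg] at h2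
      rw [sq, ← h2, neg_neg]
    have h3 : ‖q.im‖ ≠ 0 := norm_ne_zero_iff.mpr h
    rw [h0, sq, smul_mul_smul_comm, h1, smul_neg, ← Quaternion.coe_smul, smul_eq_mul,
      show ‖q.im‖⁻¹ * ‖q.im‖⁻¹ * ‖q.im‖ ^ 2 = 1 by field_simp, Quaternion.coe_one]

theorem eq_add_smul_imUnit (q : ℍ[ℝ]) : (q.re : ℍ[ℝ]) + ‖q.im‖ • imUnit q = q := by
  have hq : (q.re : ℍ[ℝ]) + q.im = q := Quaternion.re_add_im q
  by_cases h : q.im = 0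
  · rw [h, add_zero] at hq
    rw [h, norm_zero, zero_smul, add_zero, hq]
  · have h0 : imUnit q = ‖q.im‖⁻¹ • q.im := if_neg h
    rw [h0, smul_smul, mul_inv_cancel₀ (norm_ne_zero_iff.mpr h), one_smul, hq]

/-- For regular `f`, the Cullen derivative is given by its formula in every slice through the
point. -/
theorem cullenDeriv_eq {f : ℍ[ℝ] → ℍ[ℝ]} {Ω : Set ℍ[ℝ]} (hf : IsRegularOn f Ω) {I : ℍ[ℝ]}
    (hI : I ^ 2 = -1) {x y : ℝ} (hq : (x : ℍ[ℝ]) + y • I ∈ Ω) :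
    cullenDeriv f ((x : ℍ[ℝ]) + y • I) = (1 / 2 : ℝ) • (lineDeriv ℝ f ((x : ℍ[ℝ]) + y • I) 1
      - I * lineDeriv ℝ f ((x : ℍ[ℝ]) + y • I) I) := by
  set q := (x : ℍ[ℝ]) + y • I with hqdef
  have h0 : (1 / 2 : ℝ) ≠ 0 := by norm_num
  have h1 : lineDeriv ℝ f q 1 + I * lineDeriv ℝ f q I = 0 :=
    (smul_eq_zero.mp (hf I hI x y hq).2).resolve_left h0
  have h2 : lineDeriv ℝ f q 1 + imUnit q * lineDeriv ℝ f q (imUnit q) = 0 := by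
    have := (hf (imUnit q) (imUnit_sq q) q.re ‖q.im‖ (by rwa [eq_add_smul_imUnit])).2
    rw [eq_add_smul_imUnit] at this
    exact (smul_eq_zero.mp this).resolve_left h0
  rw [cullenDeriv, eq_neg_of_add_eq_zero_right h1, eq_neg_of_add_eq_zero_right h2]

end SliceRegular

end

noncomputable section

namespace SliceRegular

open PowerSeries (X C)

/-! The values of a `*`-product are not products of values. The remedy is to let a power series act
on a weight: at a point `q` it sends `w` to `∑ qⁿ w aₙ`, and then `*`-products become compositions
of real-linear maps (`ev_mul`). A regular self-map of the ball acts by contractions for every `q`,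
since a nonzero weight `w` only conjugates `q`. This turns the noncommutative problem into norm
estimates for operators.

Put `a = f(q₀)`. The Neumann series inverts `1 - a̅ * f`, hence its symmetrization has no zeros, and
every quotient becomes a product with the inverse series. The identity `|v + w a|² - |w + v a̅|² =
(|v|² - |w|²)(1 - |a|²)` makes `(f - a) * (1 - a̅ * f)⁻*` contractive (`Contractive.schwarzPick`).
The vanishing derivatives allow a factor `(q - q₀)^{*n}` to be split off on the left
(`exists_eq_X_sub_pow_mul`). Replacing each `q - q₀` by `1 - q̅₀ * q` preserves contractivity
(`Contractive.replace_factor`): the two factors have asymptotically the same size at the boundary,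
and the maximum principle does the rest. The resulting series is the quotient of the two sides of
the claim; evaluating it at `q₀` gives the derivative bound. -/

/-- The power series `η` converges absolutely on the unit ball. -/
def Converges (η : PowerSeries ℍ[ℝ]) : Prop :=
  ∀ r : ℝ, 0 ≤ r → r < 1 → Summable fun n => ‖PowerSeries.coeff n η‖ * r ^ n

/-- The value `∑ qⁿ w aₙ` of the power series `η = ∑ Xⁿ aₙ`. For `w ≠ 0` it is
`w * η (w⁻¹ * q * w)`. -/
def ev (η : PowerSeries ℍ[ℝ]) (q w : ℍ[ℝ]) : ℍ[ℝ] :=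
  ∑' n : ℕ, q ^ n * w * PowerSeries.coeff n η

/-- The function `f` is the sum of the power series `η` on the unit ball. -/
def Represents (η : PowerSeries ℍ[ℝ]) (f : ℍ[ℝ] → ℍ[ℝ]) : Prop :=
  HasSeries f fun n => PowerSeries.coeff n η

/-! ### Convergence, evaluation and products of power series -/

theorem mem_unitBall {q : ℍ[ℝ]} : q ∈ unitBall ↔ ‖q‖ < 1 := by
  simp [unitBall]

theorem converges_of_bounded {η : PowerSeries ℍ[ℝ]}
    (h : ∀ r : ℝ, 0 < r → r < 1 → ∃ B, ∀ n, ‖PowerSeries.coeff n η‖ * r ^ n ≤ B) :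
    Converges η := by
  intro r hr0 hr1
  obtain ⟨s, hrs, hs1⟩ := exists_between hr1
  have hs0 : 0 < s := hr0.trans_lt hrs
  obtain ⟨B, hB⟩ := h s hs0 hs1
  have hq : r / s < 1 := (div_lt_one hs0).mpr hrs
  refine Summable.of_nonneg_of_le (fun n => by positivity) (fun n => ?_)
    ((summable_geometric_of_lt_one (by positivity) hq).mul_left B)
  calc ‖PowerSeries.coeff n η‖ * r ^ n
      = ‖PowerSeries.coeff n η‖ * s ^ n * (r / s) ^ n := by
        rw [mul_assoc, ← mul_pow, mul_div_cancel₀ _ hs0.ne']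
    _ ≤ B * (r / s) ^ n := by gcongr; exact hB n

theorem Converges.bounded {η : PowerSeries ℍ[ℝ]} (h : Converges η) {r : ℝ} (hr0 : 0 ≤ r)
    (hr1 : r < 1) : ∃ B, ∀ n, ‖PowerSeries.coeff n η‖ * r ^ n ≤ B :=
  ⟨_, fun n => (h r hr0 hr1).le_tsum n fun _ _ => by positivity⟩

theorem Represents.converges {η : PowerSeries ℍ[ℝ]} {f : ℍ[ℝ] → ℍ[ℝ]} (h : Represents η f) :
    Converges η := by
  refine converges_of_bounded fun r hr0 hr1 => ?_
  -- At the real point `r` the terms tend to zero, which bounds `‖aₙ‖ rⁿ`.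
  have hs := (h (r : ℍ[ℝ]) (mem_unitBall.mpr (by simpa [abs_of_pos hr0]))).summable
  obtain ⟨B, hB⟩ := hs.tendsto_atTop_zero.norm.bddAbove_range
  refine ⟨B, fun n => ?_⟩
  have := hB ⟨n, rfl⟩
  simpa [abs_of_pos hr0, mul_comm] using this

theorem Converges.summable_norm {η : PowerSeries ℍ[ℝ]} (h : Converges η) {q : ℍ[ℝ]}
    (hq : ‖q‖ < 1) (w : ℍ[ℝ]) : Summable fun n => ‖q ^ n * w * PowerSeries.coeff n η‖ := by
  refine ((h ‖q‖ (norm_nonneg _) hq).mul_left ‖w‖).congr fun n => ?_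
  rw [norm_mul, norm_mul, norm_pow]
  ring

theorem Converges.summable {η : PowerSeries ℍ[ℝ]} (h : Converges η) {q : ℍ[ℝ]}
    (hq : ‖q‖ < 1) (w : ℍ[ℝ]) : Summable fun n => q ^ n * w * PowerSeries.coeff n η :=
  (h.summable_norm hq w).of_norm

theorem Converges.represents {η : PowerSeries ℍ[ℝ]} (h : Converges η) :
    Represents η fun q => ev η q 1 := by
  intro q hq
  simpa [ev] using (h.summable (mem_unitBall.mp hq) 1).hasSum

theorem Represents.ev_eq {η : PowerSeries ℍ[ℝ]} {f : ℍ[ℝ] → ℍ[ℝ]} (h : Represents η f)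
    {q : ℍ[ℝ]} (hq : q ∈ unitBall) : ev η q 1 = f q := by
  simpa [ev] using (h q hq).tsum_eq

theorem Represents.congr {η : PowerSeries ℍ[ℝ]} {f g : ℍ[ℝ] → ℍ[ℝ]} (h : Represents η f)
    (hfg : ∀ q ∈ unitBall, g q = f q) : Represents η g := by
  intro q hq
  rw [hfg q hq]
  exact h q hq

theorem Represents.sub {η ψ : PowerSeries ℍ[ℝ]} {f g : ℍ[ℝ] → ℍ[ℝ]} (h : Represents η f)
    (h' : Represents ψ g) : Represents (η - ψ) fun q => f q - g q := by
  intro q hq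
  simpa [mul_sub] using (h q hq).sub (h' q hq)

theorem represents_const (a : ℍ[ℝ]) : Represents (C a) fun _ => a := by
  intro q _
  convert hasSum_ite_eq (0 : ℕ) a using 2 with n
  beta_reduce
  rw [PowerSeries.coeff_C]
  split_ifs with h <;> simp [h]

theorem represents_id : Represents X fun q => q := by
  intro q _
  convert hasSum_ite_eq (1 : ℕ) q using 2 with n
  beta_reduce
  rw [PowerSeries.coeff_X]
  split_ifs with h <;> simp [h]

theorem converges_C (a : ℍ[ℝ]) : Converges (C a) := (represents_const a).converges

theorem converges_X : Converges X := represents_id.converges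

theorem Converges.sub {η ψ : PowerSeries ℍ[ℝ]} (h : Converges η) (h' : Converges ψ) :
    Converges (η - ψ) :=
  (h.represents.sub h'.represents).converges

theorem converges_one : Converges 1 := by
  simpa using converges_C 1

theorem Converges.mul {η ψ : PowerSeries ℍ[ℝ]} (h : Converges η) (h' : Converges ψ) :
    Converges (η * ψ) := by
  intro r hr0 hr1
  have hr : ‖(r : ℍ[ℝ])‖ < 1 := by simpa [abs_of_nonneg hr0]
  refine (summable_norm_sum_mul_antidiagonal_of_summable_norm
    (h.summable_norm hr 1) (h'.summable_norm hr 1)).congr fun n => ?_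
  have : ∑ kl ∈ Finset.HasAntidiagonal.antidiagonal n, (r : ℍ[ℝ]) ^ kl.1 * 1 * PowerSeries.coeff kl.1 η *
      ((r : ℍ[ℝ]) ^ kl.2 * 1 * PowerSeries.coeff kl.2 ψ)
      = (r : ℍ[ℝ]) ^ n * PowerSeries.coeff n (η * ψ) := by
    rw [PowerSeries.coeff_mul, Finset.mul_sum]
    refine Finset.sum_congr rfl fun kl hkl => ?_
    rw [← Finset.HasAntidiagonal.mem_antidiagonal.mp hkl, pow_add]
    simp only [← Quaternion.coe_pow, mul_one, Quaternion.coe_mul_eq_smul, smul_mul_assoc,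
      mul_smul_comm]
    exact smul_comm _ _ _
  rw [this, norm_mul, norm_pow, Quaternion.norm_coe, Real.norm_of_nonneg hr0, mul_comm]

theorem Converges.pow {η : PowerSeries ℍ[ℝ]} (h : Converges η) (n : ℕ) : Converges (η ^ n) := by
  induction n with
  | zero => simpa using converges_one
  | succ n ih => rw [pow_succ]; exact ih.mul h

/-- The reason for carrying a weight: the value of the first factor becomes the weight of the
second. Absolute convergence permits summing the double series either by total degree or one index
at a time. -/
theorem ev_mul {η ψ : PowerSeries ℍ[ℝ]} (h : Converges η) (h' : Converges ψ) {q : ℍ[ℝ]}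
    (hq : ‖q‖ < 1) (w : ℍ[ℝ]) : ev (η * ψ) q w = ev ψ q (ev η q w) := by
  let F : ℕ × ℕ → ℍ[ℝ] := fun p =>
    q ^ p.2 * (q ^ p.1 * w * PowerSeries.coeff p.1 η) * PowerSeries.coeff p.2 ψ
  have hF : Summable F := by
    refine Summable.of_norm ?_
    refine (Summable.mul_of_nonneg (h.summable_norm hq w) (h'.summable_norm hq 1)
      (fun _ => norm_nonneg _) (fun _ => norm_nonneg _)).congr fun p => ?_
    simp only [F, norm_mul, norm_one]
    ring
  have h1 : ∑' p, F p = ev (η * ψ) q w := by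
    rw [← Finset.HasAntidiagonal.sigmaAntidiagonalEquivProd.tsum_eq F]
    refine (Summable.tsum_sigma' (fun n => (hasSum_fintype _).summable)
      ((Finset.HasAntidiagonal.sigmaAntidiagonalEquivProd.summable_iff).mpr hF)).trans ?_
    refine tsum_congr fun n => ?_
    rw [tsum_fintype, PowerSeries.coeff_mul, Finset.mul_sum]
    refine (Finset.sum_coe_sort (Finset.HasAntidiagonal.antidiagonal n) F).trans ?_
    refine Finset.sum_congr rfl fun p hp => ?_
    simp only [F]
    rw [← Finset.HasAntidiagonal.mem_antidiagonal.mp hp, add_comm, pow_add]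
    simp only [mul_assoc]
  have h2 : ∑' p, F p = ev ψ q (ev η q w) := by
    rw [← (Equiv.prodComm ℕ ℕ).tsum_eq F]
    refine (Summable.tsum_prod ((Equiv.prodComm ℕ ℕ).summable_iff.mpr hF)).trans ?_
    refine tsum_congr fun n => ?_
    simp only [ev, Function.comp_def, Equiv.prodComm_apply, Prod.swap, F]
    rw [tsum_mul_right, tsum_mul_left]
  rw [← h1, h2]

theorem ev_sub {η ψ : PowerSeries ℍ[ℝ]} (h : Converges η) (h' : Converges ψ) {q : ℍ[ℝ]}
    (hq : ‖q‖ < 1) (w : ℍ[ℝ]) : ev (η - ψ) q w = ev η q w - ev ψ q w := by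
  simp only [ev, map_sub, mul_sub]
  exact (h.summable hq w).tsum_sub (h'.summable hq w)

theorem ev_C (a q w : ℍ[ℝ]) : ev (C a) q w = w * a := by
  rw [ev, tsum_eq_single 0 (fun n hn => by rw [PowerSeries.coeff_C, if_neg hn, mul_zero])]
  simp

theorem ev_one (q w : ℍ[ℝ]) : ev 1 q w = w := by
  simpa using ev_C 1 q w

theorem ev_X (q w : ℍ[ℝ]) : ev X q w = q * w := by
  rw [ev, tsum_eq_single 1 (fun n hn => by rw [PowerSeries.coeff_X, if_neg hn, mul_zero])]
  simp

theorem ev_smul_right (η : PowerSeries ℍ[ℝ]) (q w : ℍ[ℝ]) (r : ℝ) :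
    ev η q (r • w) = r • ev η q w := by
  simp only [ev, mul_smul_comm, smul_mul_assoc]
  exact tsum_const_smul'' r

theorem ev_eq_conj (η : PowerSeries ℍ[ℝ]) (q : ℍ[ℝ]) {w : ℍ[ℝ]} (hw : w ≠ 0) :
    ev η q w = w * ev η (w⁻¹ * q * w) 1 := by
  rw [ev, ev, ← tsum_mul_left]
  refine tsum_congr fun n => ?_
  have h : ∀ n : ℕ, (w⁻¹ * q * w) ^ n = w⁻¹ * q ^ n * w := by
    intro n
    induction n with
    | zero => simp [hw]
    | succ n ih => rw [pow_succ, ih, pow_succ]; simp [mul_assoc, hw]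
  rw [h, mul_one, ← mul_assoc, ← mul_assoc, ← mul_assoc, mul_inv_cancel₀ hw, one_mul]

/-! ### Series bounded by one on the ball -/

/-- The power series has values of norm at most one on the unit ball; by `ev_eq_conj` the condition
for general `w` follows from that for `w = 1`. -/
def Contractive (η : PowerSeries ℍ[ℝ]) : Prop :=
  Converges η ∧ ∀ q : ℍ[ℝ], ‖q‖ < 1 → ∀ w, ‖ev η q w‖ ≤ ‖w‖

theorem Represents.contractive {η : PowerSeries ℍ[ℝ]} {f : ℍ[ℝ] → ℍ[ℝ]} (h : Represents η f)
    (hf : Set.MapsTo f unitBall unitBall) : Contractive η := by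
  refine ⟨h.converges, fun q hq w => ?_⟩
  by_cases hw : w = 0
  · simp [hw, ev]
  · have hq' : w⁻¹ * q * w ∈ unitBall := by
      rw [mem_unitBall, norm_mul, norm_mul, norm_inv, mul_right_comm,
        inv_mul_cancel₀ (norm_ne_zero_iff.mpr hw), one_mul]
      exact hq
    rw [ev_eq_conj η q hw, norm_mul, h.ev_eq hq']
    exact mul_le_of_le_one_right (norm_nonneg _) (mem_unitBall.mp (hf hq')).le

theorem contractive_X : Contractive X :=
  represents_id.contractive fun _ h => h

/-! ### The regular operations in terms of power series -/

theorem Represents.coeff_eq {η : PowerSeries ℍ[ℝ]} {f : ℍ[ℝ] → ℍ[ℝ]} (h : Represents η f) :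
    coeff f = fun n => PowerSeries.coeff n η :=
  HasSeries.coeff_eq h

theorem Represents.starMul {η ψ : PowerSeries ℍ[ℝ]} {f g : ℍ[ℝ] → ℍ[ℝ]} (h : Represents η f)
    (h' : Represents ψ g) : Represents (η * ψ) (starMul f g) := by
  refine (h.converges.mul h'.converges).represents.congr fun q _ => ?_
  rw [SliceRegular.starMul, ev]
  refine tsum_congr fun n => ?_
  rw [PowerSeries.coeff_mul, h.coeff_eq, h'.coeff_eq, mul_one,
    Finset.Nat.sum_antidiagonal_eq_sum_range_succ_mk]

theorem Represents.starPow {η : PowerSeries ℍ[ℝ]} {f : ℍ[ℝ] → ℍ[ℝ]} (h : Represents η f)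
    (n : ℕ) : Represents (η ^ n) (starPow f n) := by
  induction n with
  | zero => simpa [SliceRegular.starPow] using represents_const 1
  | succ n ih => rw [pow_succ]; exact ih.starMul h

/-- The power series with conjugate coefficients. -/
def conjSeries (η : PowerSeries ℍ[ℝ]) : PowerSeries ℍ[ℝ] :=
  PowerSeries.mk fun n => star (PowerSeries.coeff n η)

theorem Converges.conjSeries {η : PowerSeries ℍ[ℝ]} (h : Converges η) :
    Converges (conjSeries η) := by
  intro r hr0 hr1
  simpa [SliceRegular.conjSeries, Quaternion.norm_star] using h r hr0 hr1

theorem Represents.conj {η : PowerSeries ℍ[ℝ]} {f : ℍ[ℝ] → ℍ[ℝ]} (h : Represents η f) :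
    Represents (conjSeries η) (conj f) := by
  refine h.converges.conjSeries.represents.congr fun q _ => ?_
  simp [SliceRegular.conj, ev, h.coeff_eq, conjSeries]

theorem conjSeries_mul (η ψ : PowerSeries ℍ[ℝ]) :
    conjSeries (η * ψ) = conjSeries ψ * conjSeries η := by
  ext1 n
  simp only [conjSeries, PowerSeries.coeff_mk, PowerSeries.coeff_mul, star_sum, star_mul]
  rw [← Finset.Nat.sum_antidiagonal_swap]
  rfl

theorem conjSeries_conjSeries (η : PowerSeries ℍ[ℝ]) : conjSeries (conjSeries η) = η := by
  ext1 n
  simp [conjSeries]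

theorem conjSeries_one : conjSeries 1 = 1 := by
  ext1 n
  simp only [conjSeries, PowerSeries.coeff_mk, PowerSeries.coeff_one]
  split_ifs <;> simp

/-- Self-conjugate coefficients are real, hence central. -/
theorem commute_of_conjSeries_eq {σ : PowerSeries ℍ[ℝ]} (h : conjSeries σ = σ)
    (η : PowerSeries ℍ[ℝ]) : Commute σ η := by
  have hc : ∀ n (a : ℍ[ℝ]), PowerSeries.coeff n σ * a = a * PowerSeries.coeff n σ := by
    intro n a
    have h1 : star (PowerSeries.coeff n σ) = PowerSeries.coeff n σ := by
      conv_rhs => rw [← h]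
      simp [conjSeries]
    rw [Quaternion.star_eq_self.mp h1]
    exact Quaternion.coe_commutes _ _
  ext1 n
  rw [PowerSeries.coeff_mul, PowerSeries.coeff_mul, ← Finset.Nat.sum_antidiagonal_swap]
  exact Finset.sum_congr rfl fun p _ => hc _ _

theorem commute_mul_conjSeries (η ψ : PowerSeries ℍ[ℝ]) : Commute (η * conjSeries η) ψ :=
  commute_of_conjSeries_eq (by rw [conjSeries_mul, conjSeries_conjSeries]) ψ

/-- Symmetrization is multiplicative because `χ * conjSeries χ` is central. So the symmetrization of
an invertible series is invertible, and an invertible series cannot evaluate to zero, as zero would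
be the weight of the next factor. -/
theorem Represents.symm_ne_zero {ψ χ : PowerSeries ℍ[ℝ]} {g : ℍ[ℝ] → ℍ[ℝ]}
    (hg : Represents ψ g) (hχ : Converges χ) (h : ψ * χ = 1) {q : ℍ[ℝ]} (hq : q ∈ unitBall) :
    symm g q ≠ 0 := by
  have h1 : (ψ * conjSeries ψ) * (χ * conjSeries χ) = 1 := by
    rw [mul_assoc, ← (commute_mul_conjSeries χ (conjSeries ψ)).eq, mul_assoc, ← mul_assoc,
      h, one_mul, ← conjSeries_mul, h, conjSeries_one]
  have hq' := mem_unitBall.mp hq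
  have h2 := ev_mul (hg.converges.mul hg.converges.conjSeries) (hχ.mul hχ.conjSeries) hq' 1
  rw [h1, ev_one] at h2
  intro h0
  have h3 : ev (ψ * conjSeries ψ) q 1 = 0 := ((hg.starMul hg.conj).ev_eq hq).trans h0
  rw [h3] at h2
  simp [ev] at h2

/-- The symmetrization of the denominator is central, so it can be moved to the last position in the
product, where it acts by left multiplication with its value; this cancels the inverse in the
definition of `starDiv`. -/
theorem Represents.starDiv_eq {η ψ χ : PowerSeries ℍ[ℝ]} {f g : ℍ[ℝ] → ℍ[ℝ]}
    (hf : Represents η f) (hg : Represents ψ g) (hχ : Converges χ) (h : χ * ψ = 1) (h' : ψ * χ = 1)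
    {q : ℍ[ℝ]} (hq : q ∈ unitBall) : starDiv f g q = ev (η * χ) q 1 := by
  have hq' := mem_unitBall.mp hq
  have hs := hg.symm_ne_zero hχ h' hq
  have h1 : η * conjSeries ψ = (ψ * conjSeries ψ) * (η * χ) := by
    rw [(commute_mul_conjSeries ψ (η * χ)).eq, mul_assoc, ← mul_assoc χ, h, one_mul]
  -- Evaluating both sides of `σ * w = w * σ` for the constant `w` shows how the central series acts
  -- on a weight.
  have hσ : ∀ w, ev (ψ * conjSeries ψ) q w = symm g q * w := by
    intro w
    have h2 : (ψ * conjSeries ψ) * C w = C w * (ψ * conjSeries ψ) :=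
      (commute_mul_conjSeries ψ (C w)).eq
    have hc := hg.converges.mul hg.converges.conjSeries
    have h3 := congrArg (fun η => ev η q 1) h2
    simp only [ev_mul hc (converges_C w) hq', ev_mul (converges_C w) hc hq', ev_C, one_mul] at h3
    rw [← h3, (hg.starMul hg.conj).ev_eq hq]
    rfl
  rw [starDiv, ← (hf.starMul hg.conj).ev_eq hq, h1, ← (commute_mul_conjSeries ψ _).eq.symm,
    ev_mul (hf.converges.mul hχ) (hg.converges.mul hg.converges.conjSeries) hq', hσ,
    inv_mul_cancel_left₀ hs]

theorem represents_oneSubStar {η : PowerSeries ℍ[ℝ]} {f : ℍ[ℝ] → ℍ[ℝ]} (h : Represents η f)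
    (a : ℍ[ℝ]) : Represents (1 - C (star a) * η) (oneSubStar a f) := by
  have h1 : Represents 1 fun _ => (1 : ℍ[ℝ]) := by simpa using represents_const 1
  exact h1.sub ((represents_const (star a)).starMul h)

/-! ### The complex structure on the quaternions given by an imaginary unit -/

/-- The embedding `x + i y ↦ x + y I` of the complex numbers. -/
def sliceHom {I : ℍ[ℝ]} (hI : I ^ 2 = -1) : ℂ →ₐ[ℝ] ℍ[ℝ] :=
  Complex.lift ⟨I, by rw [← sq, hI]⟩

theorem sliceHom_apply {I : ℍ[ℝ]} (hI : I ^ 2 = -1) (z : ℂ) :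
    sliceHom hI z = (z.re : ℍ[ℝ]) + z.im • I := by
  simp [sliceHom, Complex.liftAux_apply]

theorem norm_sliceHom {I : ℍ[ℝ]} (hI : I ^ 2 = -1) (z : ℂ) : ‖sliceHom hI z‖ = ‖z‖ := by
  have h1 : ‖I‖ = 1 := by
    have h := congrArg norm hI
    rw [norm_pow, norm_neg, norm_one] at h
    exact (pow_eq_one_iff_of_nonneg (norm_nonneg _) two_ne_zero).mp h
  have h2 : star I = -I := by
    have hI0 : I ≠ 0 := fun h => by simp [h] at h1
    refine mul_right_cancel₀ hI0 ?_
    rw [Quaternion.star_mul_self, Quaternion.normSq_eq_norm_mul_self, h1, neg_mul, ← sq I, hI]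
    simp
  have h3 : ‖sliceHom hI z‖ * ‖sliceHom hI z‖ = ‖z‖ * ‖z‖ := by
    rw [← Quaternion.normSq_eq_norm_mul_self, ← Quaternion.coe_inj, ← Quaternion.self_mul_star,
      sliceHom_apply, star_add, Quaternion.star_smul, h2, Quaternion.star_coe, Complex.norm_mul_self_eq_normSq,
      Complex.normSq_apply]
    have hc : (z.re : ℍ[ℝ]) * I = I * z.re := Quaternion.coe_commutes _ _
    have hII : I * I = -1 := by rw [← sq, hI]
    simp only [mul_add, add_mul, smul_mul_assoc, mul_smul_comm, mul_neg, smul_neg, hII, hc]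
    simp [smul_smul, Quaternion.ext_iff]
    ring
  exact (mul_self_inj (norm_nonneg _) (norm_nonneg _)).mp h3

/-- The quaternions as a complex vector space, `z` acting as left multiplication by
`sliceHom hI z`. -/
abbrev sliceModule {I : ℍ[ℝ]} (hI : I ^ 2 = -1) : NormedSpace ℂ ℍ[ℝ] where
  toModule := Module.compHom ℍ[ℝ] (sliceHom hI).toRingHom
  norm_smul_le z q := by
    change ‖sliceHom hI z * q‖ ≤ _
    rw [norm_mul, norm_sliceHom]

/-! ### Power series expansion, Cauchy estimates and the maximum principle on slices -/

/-- The real interval lies in every slice, so this identifies coefficients that were obtained from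
different slices. -/
theorem eq_of_forall_real_hasSum {a b : ℕ → ℍ[ℝ]} {g : ℝ → ℍ[ℝ]}
    (ha : ∀ x : ℝ, |x| < 1 → HasSum (fun n => x ^ n • a n) (g x))
    (hb : ∀ x : ℝ, |x| < 1 → HasSum (fun n => x ^ n • b n) (g x)) : a = b := by
  let P : (ℕ → ℍ[ℝ]) → FormalMultilinearSeries ℝ ℝ ℍ[ℝ] := fun c n =>
    ContinuousMultilinearMap.mkPiRing ℝ (Fin n) (c n)
  have hP : ∀ c n, (P c).coeff n = c n := by
    intro c n
    rw [FormalMultilinearSeries.coeff]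
    exact (ContinuousMultilinearMap.mkPiRing_apply _ _).trans (by simp)
  have key : ∀ c : ℕ → ℍ[ℝ], (∀ x : ℝ, |x| < 1 → HasSum (fun n => x ^ n • c n) (g x)) →
      HasFPowerSeriesAt g (P c) 0 := by
    intro c hc
    refine hasFPowerSeriesAt_iff.mpr ?_
    filter_upwards [Metric.ball_mem_nhds (0 : ℝ) one_pos] with x hx
    simpa only [hP, zero_add] using hc x (by simpa using hx)
  have h := (key a ha).eq_formalMultilinearSeries (key b hb)
  funext n
  rw [← hP a n, h, hP]

/-- Holomorphic functions on the unit disc with values in the quaternions are sums of power series,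
with Cauchy's estimate for the coefficients. -/
theorem exists_slice_series {I : ℍ[ℝ]} (hI : I ^ 2 = -1) {F : ℂ → ℍ[ℝ]}
    (hF : letI := sliceModule hI; DifferentiableOn ℂ F (Metric.ball 0 1)) :
    ∃ c : ℕ → ℍ[ℝ],
      (∀ z : ℂ, ‖z‖ < 1 → HasSum (fun n => sliceHom hI z ^ n * c n) (F z)) ∧
      ∀ B : ℝ, (∀ z : ℂ, ‖z‖ < 1 → ‖F z‖ ≤ B) →
        ∀ r : ℝ, 0 < r → r < 1 → ∀ n, ‖c n‖ ≤ B / r ^ n := by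
  let _ := sliceModule hI
  refine ⟨fun n => (n ! : ℂ)⁻¹ • iteratedDeriv n F 0, fun z hz => ?_, fun B hB r hr0 hr1 n => ?_⟩
  · refine (Complex.hasSum_taylorSeries_on_ball hF (z := z) (by simpa using hz)).congr_fun ?_
    intro n
    rw [sub_zero, smul_comm]
    rw [← map_pow]
    rfl
  · have h := Complex.norm_iteratedDeriv_le_of_forall_mem_sphere_norm_le (C := B) n hr0
      ((hF.mono (by rw [closure_ball _ hr0.ne']; exact Metric.closedBall_subset_ball hr1)).diffContOnCl)
      (fun z hz => hB z (by rw [mem_sphere_zero_iff_norm.mp hz]; exact hr1))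
    have h0 : (0 : ℝ) < n ! := by exact_mod_cast n.factorial_pos
    rw [norm_smul, norm_inv, Complex.norm_natCast, inv_mul_le_iff₀ h0]
    rwa [← mul_div_assoc]

/-- The regularity equation says that the real differential on the slice commutes with left
multiplication by `I`, which is complex linearity for `sliceModule`. -/
theorem IsRegularOn.differentiableOn_slice {f : ℍ[ℝ] → ℍ[ℝ]} (hf : IsRegularOn f unitBall)
    {I : ℍ[ℝ]} (hI : I ^ 2 = -1) : letI := sliceModule hI
    DifferentiableOn ℂ (fun z : ℂ => f (sliceHom hI z)) (Metric.ball 0 1) := by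
  let _ := sliceModule hI
  intro z hz
  have hz1 : sliceHom hI z ∈ unitBall := by
    rw [mem_unitBall, norm_sliceHom]; simpa using hz
  rw [sliceHom_apply] at hz1
  obtain ⟨hd, hcr⟩ := hf I hI z.re z.im hz1
  set q : ℍ[ℝ] := (z.re : ℍ[ℝ]) + z.im • I with hq
  set G : ℝ × ℝ → ℍ[ℝ] := fun p => f ((p.1 : ℍ[ℝ]) + p.2 • I) with hG
  have hd' := hd.hasFDerivAt
  set A := fderiv ℝ G (z.re, z.im) with hA
  have hl : ∀ v : ℝ × ℝ, lineDeriv ℝ f q ((v.1 : ℍ[ℝ]) + v.2 • I) = A v := by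
    intro v
    rw [← (hd'.hasLineDerivAt v).lineDeriv, lineDeriv, lineDeriv]
    congr 1
    funext t
    simp only [hG, hq, Prod.fst_add, Prod.snd_add, Prod.smul_fst, Prod.smul_snd,
      Quaternion.coe_add, smul_eq_mul, Quaternion.coe_mul, smul_add, add_smul, mul_smul]
    rw [Quaternion.coe_mul_eq_smul, add_add_add_comm]
  have h1 : lineDeriv ℝ f q 1 = A (1, 0) := by simpa using hl (1, 0)
  have h2 : lineDeriv ℝ f q I = A (0, 1) := by simpa using hl (0, 1)
  have h3 : A (0, 1) = I * A (1, 0) := by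
    have h := (smul_eq_zero.mp hcr).resolve_left (by norm_num)
    rw [h1, h2] at h
    rw [eq_neg_of_add_eq_zero_left h, mul_neg, ← mul_assoc, ← sq, hI]
    simp
  have h4 : ∀ h : ℂ, A (h.re, h.im) = sliceHom hI h * A (1, 0) := by
    intro h
    have : ((h.re, h.im) : ℝ × ℝ) = h.re • (1, 0) + h.im • (0, 1) := by simp
    rw [this, map_add, map_smul, map_smul, h3, sliceHom_apply, add_mul, smul_mul_assoc,
      Quaternion.coe_mul_eq_smul]
  have h5 : HasDerivAt (fun z : ℂ => f (sliceHom hI z)) (A (1, 0)) z := by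
    rw [hasDerivAt_iff_isLittleO]
    have h6 := hd'.isLittleO
    have h7 : Filter.Tendsto (fun w : ℂ => (w.re, w.im)) (nhds z) (nhds (z.re, z.im)) :=
      (Complex.continuous_re.prodMk Complex.continuous_im).continuousAt
    have h8 := h6.comp_tendsto h7
    refine (h8.congr_left fun w => ?_).trans_isBigO ?_
    · simp only [Function.comp_apply, hG]
      rw [← sliceHom_apply hI w, ← sliceHom_apply hI z, Prod.mk_sub_mk, ← Complex.sub_re,
        ← Complex.sub_im, h4]
      rfl
    · refine Asymptotics.IsBigO.of_bound 1 (Filter.Eventually.of_forall fun w => ?_)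
      rw [one_mul]
      simp only [Function.comp_apply, Prod.mk_sub_mk, ← Complex.sub_re, ← Complex.sub_im]
      exact max_le (Complex.abs_re_le_norm (w - z)) (Complex.abs_im_le_norm (w - z))
  exact h5.differentiableAt.differentiableWithinAt

theorem iUnit_sq : iUnit ^ 2 = -1 := by
  rw [sq]
  ext <;> simp <;> simp [iUnit]

/-- Regular functions on the unit ball are sums of power series. -/
theorem IsRegularOn.exists_represents {f : ℍ[ℝ] → ℍ[ℝ]} (hf : IsRegularOn f unitBall) :
    ∃ η : PowerSeries ℍ[ℝ], Represents η f := by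
  have key : ∀ I : ℍ[ℝ], ∀ hI : I ^ 2 = -1, ∃ c : ℕ → ℍ[ℝ],
      ∀ z : ℂ, ‖z‖ < 1 → HasSum (fun n => sliceHom hI z ^ n * c n) (f (sliceHom hI z)) :=
    fun I hI => (exists_slice_series hI (hf.differentiableOn_slice hI)).imp fun c hc => hc.1
  have real : ∀ (I : ℍ[ℝ]) (hI : I ^ 2 = -1) (c : ℕ → ℍ[ℝ]),
      (∀ z : ℂ, ‖z‖ < 1 → HasSum (fun n => sliceHom hI z ^ n * c n) (f (sliceHom hI z))) →
      ∀ x : ℝ, |x| < 1 → HasSum (fun n => x ^ n • c n) (f (x : ℍ[ℝ])) := by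
    intro I hI c hc x hx
    have h1 : sliceHom hI (x : ℂ) = (x : ℍ[ℝ]) := by simp
    have h2 := hc x (by simpa using hx)
    rw [h1] at h2
    simpa only [← Quaternion.coe_pow, Quaternion.coe_mul_eq_smul] using h2
  obtain ⟨a, ha⟩ := key iUnit iUnit_sq
  refine ⟨PowerSeries.mk a, fun q hq => ?_⟩
  obtain ⟨c, hc⟩ := key (imUnit q) (imUnit_sq q)
  -- The expansion found in the slice of `iUnit` is thus valid in the slice through `q`.
  have hac : a = c := eq_of_forall_real_hasSum (real _ _ a ha) (real _ _ c hc)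
  have hz : sliceHom (imUnit_sq q) ⟨q.re, ‖q.im‖⟩ = q := by
    rw [sliceHom_apply, eq_add_smul_imUnit]
  have h := hc ⟨q.re, ‖q.im‖⟩ (by rw [← norm_sliceHom (imUnit_sq q), hz]; exact mem_unitBall.mp hq)
  rw [hz, ← hac] at h
  simpa only [PowerSeries.coeff_mk] using h

theorem Converges.differentiableOn_slice {η : PowerSeries ℍ[ℝ]} (h : Converges η)
    {I : ℍ[ℝ]} (hI : I ^ 2 = -1) (w : ℍ[ℝ]) : letI := sliceModule hI
    DifferentiableOn ℂ (fun z : ℂ => ev η (sliceHom hI z) w) (Metric.ball 0 1) := by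
  let _ := sliceModule hI
  intro z hz
  obtain ⟨r, hzr, hr1⟩ := exists_between (mem_ball_zero_iff.mp hz)
  have hr0 : 0 ≤ r := (norm_nonneg _).trans hzr.le
  have hd : DifferentiableOn ℂ (fun z : ℂ => ∑' n, z ^ n • (w * PowerSeries.coeff n η))
      (Metric.ball 0 r) := by
    refine Complex.differentiableOn_tsum_of_summable_norm ((h r hr0 hr1).mul_left ‖w‖)
      (fun n => ((differentiable_id.pow n).smul_const _).differentiableOn) Metric.isOpen_ball
      (fun n z hz => ?_)
    have hz' := (mem_ball_zero_iff.mp hz).le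
    rw [norm_smul, norm_pow, norm_mul]
    calc ‖z‖ ^ n * (‖w‖ * ‖PowerSeries.coeff n η‖)
        ≤ r ^ n * (‖w‖ * ‖PowerSeries.coeff n η‖) := by gcongr
      _ = ‖w‖ * (‖PowerSeries.coeff n η‖ * r ^ n) := by ring
  have he : (fun z : ℂ => ev η (sliceHom hI z) w)
      = fun z : ℂ => ∑' n, z ^ n • (w * PowerSeries.coeff n η) := by
    funext z
    refine tsum_congr fun n => ?_
    rw [mul_assoc, ← map_pow]
    rfl
  rw [he]
  exact (hd.differentiableAt (Metric.isOpen_ball.mem_nhds (by simpa using hzr))).differentiableWithinAt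

/-- Cauchy's estimate for the coefficients. -/
theorem Converges.norm_coeff_le {η : PowerSeries ℍ[ℝ]} (h : Converges η) {B : ℝ}
    (hB : ∀ q, ‖q‖ < 1 → ‖ev η q 1‖ ≤ B) {r : ℝ} (hr0 : 0 < r) (hr1 : r < 1) (n : ℕ) :
    ‖PowerSeries.coeff n η‖ ≤ B / r ^ n := by
  obtain ⟨c, hc, hc'⟩ := exists_slice_series iUnit_sq (h.differentiableOn_slice iUnit_sq 1)
  have hac : (fun n => PowerSeries.coeff n η) = c := by
    have hreal : ∀ x : ℝ, sliceHom iUnit_sq (x : ℂ) = (x : ℍ[ℝ]) := by simp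
    refine eq_of_forall_real_hasSum (g := fun x => ev η (x : ℍ[ℝ]) 1) (fun x hx => ?_)
      fun x hx => ?_
    · have := h.represents (x : ℍ[ℝ]) (mem_unitBall.mpr (by simpa using hx))
      simpa only [← Quaternion.coe_pow, Quaternion.coe_mul_eq_smul] using this
    · have := hc x (by simpa using hx)
      simpa only [hreal, ← Quaternion.coe_pow, Quaternion.coe_mul_eq_smul] using this
  have := hc' B (fun z hz => hB _ (by rwa [norm_sliceHom])) r hr0 hr1 n
  rwa [← hac] at this

/-- The maximum modulus principle, in the slice through `q`. -/
theorem Converges.norm_ev_le_of_sphere {η : PowerSeries ℍ[ℝ]} (h : Converges η) {w : ℍ[ℝ]}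
    {r B : ℝ} (hr1 : r < 1) (hB : ∀ q, ‖q‖ = r → ‖ev η q w‖ ≤ B) {q : ℍ[ℝ]}
    (hq : ‖q‖ < r) : ‖ev η q w‖ ≤ B := by
  let _ := sliceModule (imUnit_sq q)
  have hr0 : r ≠ 0 := ((norm_nonneg q).trans_lt hq).ne'
  have hz : sliceHom (imUnit_sq q) ⟨q.re, ‖q.im‖⟩ = q := by
    rw [sliceHom_apply, eq_add_smul_imUnit]
  have hd := h.differentiableOn_slice (imUnit_sq q) w
  have := Complex.norm_le_of_forall_mem_frontier_norm_le (C := B) (z := ⟨q.re, ‖q.im‖⟩)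
    (Metric.isBounded_ball (x := (0 : ℂ)) (r := r))
    ((hd.mono (by rw [closure_ball _ hr0]; exact Metric.closedBall_subset_ball hr1)).diffContOnCl)
    (fun z hz => hB _ (by
      rw [frontier_ball _ hr0] at hz
      rw [norm_sliceHom, mem_sphere_zero_iff_norm.mp hz]))
    (subset_closure (by
      rw [mem_ball_zero_iff, ← norm_sliceHom (imUnit_sq q), hz]; exact hq))
  rwa [hz] at this

/-! ### Inverses -/

theorem norm_ev_pow_le {η : PowerSeries ℍ[ℝ]} (h : Converges η) {q : ℍ[ℝ]} (hq : ‖q‖ < 1)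
    {B : ℝ} (hB0 : 0 ≤ B) (hB : ∀ w, ‖ev η q w‖ ≤ B * ‖w‖) (k : ℕ) (w : ℍ[ℝ]) :
    ‖ev (η ^ k) q w‖ ≤ B ^ k * ‖w‖ := by
  induction k with
  | zero => simp [ev_one]
  | succ k ih =>
    rw [pow_succ, ev_mul (h.pow k) h hq, pow_succ', mul_assoc]
    exact (hB _).trans (mul_le_mul_of_nonneg_left ih hB0)

/-- The Neumann series: `1 - η` has a convergent inverse. -/
theorem exists_inverse_one_sub {η : PowerSeries ℍ[ℝ]} (h : Converges η) {B : ℝ} (hB0 : 0 ≤ B)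
    (hB1 : B < 1) (hB : ∀ q : ℍ[ℝ], ‖q‖ < 1 → ∀ w, ‖ev η q w‖ ≤ B * ‖w‖) :
    ∃ χ, Converges χ ∧ χ * (1 - η) = 1 ∧ (1 - η) * χ = 1 := by
  -- Cauchy's estimate for the powers is geometric in `k`, so the Neumann series can be summed
  -- coefficient by coefficient, and the sum inherits a bound in `n`.
  have hc : ∀ r : ℝ, 0 < r → r < 1 → ∀ k n, ‖PowerSeries.coeff n (η ^ k)‖ ≤ B ^ k / r ^ n :=
    fun r hr0 hr1 k n => (h.pow k).norm_coeff_le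
      (fun q hq => by simpa using norm_ev_pow_le h hq hB0 (hB q hq) k 1) hr0 hr1 n
  have hs : ∀ n, Summable fun k => PowerSeries.coeff n (η ^ k) := fun n =>
    Summable.of_norm_bounded
      ((summable_geometric_of_lt_one hB0 hB1).div_const ((1 / 2 : ℝ) ^ n))
      fun k => hc (1 / 2) (by norm_num) (by norm_num) k n
  let χ : PowerSeries ℍ[ℝ] := PowerSeries.mk fun n => ∑' k, PowerSeries.coeff n (η ^ k)
  have hstep : ∀ n, PowerSeries.coeff n χ
      = PowerSeries.coeff n (1 : PowerSeries ℍ[ℝ]) + ∑' k, PowerSeries.coeff n (η ^ (k + 1)) := by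
    intro n
    rw [PowerSeries.coeff_mk, (hs n).tsum_eq_zero_add, pow_zero]
  have h1 : χ = 1 + χ * η := by
    ext1 n
    rw [hstep, map_add, PowerSeries.coeff_mul]
    congr 1
    simp only [χ, PowerSeries.coeff_mk, ← tsum_mul_right, pow_succ, PowerSeries.coeff_mul]
    exact Summable.tsum_finsetSum fun p _ => (hs p.1).mul_right _
  have h2 : χ = 1 + η * χ := by
    ext1 n
    rw [hstep, map_add, PowerSeries.coeff_mul]
    congr 1
    simp only [χ, PowerSeries.coeff_mk, ← tsum_mul_left, pow_succ', PowerSeries.coeff_mul]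
    exact Summable.tsum_finsetSum fun p _ => (hs p.2).mul_left _
  refine ⟨χ, converges_of_bounded fun r hr0 hr1 => ⟨∑' k, B ^ k, fun n => ?_⟩, ?_, ?_⟩
  · have hle : ‖PowerSeries.coeff n χ‖ ≤ ∑' k, B ^ k / r ^ n := by
      rw [PowerSeries.coeff_mk]
      exact tsum_of_norm_bounded
        ((summable_geometric_of_lt_one hB0 hB1).div_const _).hasSum fun k => hc r hr0 hr1 k n
    rw [tsum_div_const] at hle
    exact (le_div_iff₀ (by positivity)).mp hle
  · rw [mul_sub, mul_one, sub_eq_iff_eq_add]; exact h1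
  · rw [sub_mul, one_mul, sub_eq_iff_eq_add]; exact h2

theorem Contractive.exists_inverse {η : PowerSeries ℍ[ℝ]} (h : Contractive η) {a : ℍ[ℝ]}
    (ha : ‖a‖ < 1) : ∃ χ, Converges χ ∧ χ * (1 - C (star a) * η) = 1 ∧
      (1 - C (star a) * η) * χ = 1 := by
  refine exists_inverse_one_sub ((converges_C _).mul h.1) (norm_nonneg a) ha fun q hq w => ?_
  rw [ev_mul (converges_C _) h.1 hq, ev_C]
  refine (h.2 q hq _).trans ?_
  rw [norm_mul, Quaternion.norm_star, mul_comm]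

/-! ### The Schwarz-Pick inequality -/

theorem norm_add_sq (x y : ℍ[ℝ]) :
    ‖x + y‖ ^ 2 = ‖x‖ ^ 2 + ‖y‖ ^ 2 + 2 * inner ℝ x y := by
  rw [norm_add_sq_real]; ring

/-- Right multiplications by `a` and `star a` are adjoint. Hence `|v + w a|²` and `|w + v a̅|²` have
the same cross term. -/
theorem inner_mul_star_right (v w a : ℍ[ℝ]) : inner ℝ w (v * star a) = inner ℝ v (w * a) := by
  simp only [Quaternion.inner_def, star_mul, star_star]
  simp
  ring

theorem norm_sq_add_mul (v w a : ℍ[ℝ]) :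
    ‖v + w * a‖ ^ 2 = ‖v‖ ^ 2 + ‖w‖ ^ 2 * ‖a‖ ^ 2 + 2 * inner ℝ v (w * a) := by
  rw [norm_add_sq, norm_mul, mul_pow]

theorem norm_sq_add_mul_star (v w a : ℍ[ℝ]) :
    ‖w + v * star a‖ ^ 2 = ‖w‖ ^ 2 + ‖v‖ ^ 2 * ‖a‖ ^ 2 + 2 * inner ℝ v (w * a) := by
  rw [norm_sq_add_mul, inner_mul_star_right, Quaternion.norm_star]

/-- If `η` is contractive, so is `(η - a) * (1 - a̅ * η)⁻*`. -/
theorem Contractive.schwarzPick {η χ : PowerSeries ℍ[ℝ]} (h : Contractive η) {a : ℍ[ℝ]}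
    (ha : ‖a‖ < 1) (hχ : Converges χ) (hχ' : χ * (1 - C (star a) * η) = 1) :
    Contractive ((η - C a) * χ) := by
  have hηa := h.1.sub (converges_C a)
  have hψ := converges_one.sub ((converges_C (star a)).mul h.1)
  refine ⟨hηa.mul hχ, fun q hq w => ?_⟩
  set v := ev ((η - C a) * χ) q w with hv
  have h1 : ev (1 - C (star a) * η) q v = ev (η - C a) q w := by
    rw [hv, ← ev_mul (hηa.mul hχ) hψ hq, mul_assoc, hχ', mul_one]
  rw [ev_sub converges_one ((converges_C _).mul h.1) hq, ev_sub h.1 (converges_C a) hq, ev_one,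
    ev_mul (converges_C _) h.1 hq, ev_C, ev_C] at h1
  have hadd : ev η q (w + v * star a) = ev η q w + ev η q (v * star a) := by
    simp only [ev, mul_add, add_mul]
    exact (h.1.summable hq _).tsum_add (h.1.summable hq _)
  -- The relation defining `v` is rearranged so that `η` acts on a single weight and contractivity
  -- applies; the common cross term then cancels.
  have h2 : v + w * a = ev η q (w + v * star a) := by
    rw [hadd, ← sub_eq_sub_iff_add_eq_add, h1]
  have h3 : ‖v + w * a‖ ^ 2 ≤ ‖w + v * star a‖ ^ 2 := by
    rw [h2]; gcongr; exact h.2 q hq _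
  rw [norm_sq_add_mul, norm_sq_add_mul_star] at h3
  have h4 : ‖a‖ ^ 2 < 1 := pow_lt_one₀ (norm_nonneg _) ha two_ne_zero
  have h5 : ‖v‖ ^ 2 * (1 - ‖a‖ ^ 2) ≤ ‖w‖ ^ 2 * (1 - ‖a‖ ^ 2) := by linarith
  exact (pow_le_pow_iff_left₀ (norm_nonneg _) (norm_nonneg _) two_ne_zero).mp
    (le_of_mul_le_mul_right h5 (by linarith))

/-! ### Division by a linear factor -/

/-- Synthetic division: the coefficients of the quotient are the tails `R (n + 1)` of the series at
`a`, and the remainder is `R 0`, the value at `a`. -/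
theorem exists_eq_X_sub_mul {η : PowerSeries ℍ[ℝ]} (h : Converges η) {a : ℍ[ℝ]} (ha : ‖a‖ < 1)
    (h0 : ev η a 1 = 0) : ∃ ρ, Converges ρ ∧ η = (X - C a) * ρ := by
  have hs := h.summable ha 1
  simp only [mul_one] at hs
  have hsn : ∀ n, Summable fun k => a ^ k * PowerSeries.coeff (n + k) η := by
    intro n
    by_cases ha0 : a = 0
    · refine summable_of_ne_finset_zero (s := {0}) fun k hk => ?_
      rw [ha0, zero_pow (by simpa using hk), zero_mul]
    · have := (hs.comp_injective (add_right_injective n)).mul_left (a ^ n)⁻¹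
      refine this.congr fun k => ?_
      simp only [Function.comp_apply]
      rw [pow_add, mul_assoc, inv_mul_cancel_left₀ (pow_ne_zero _ ha0)]
  let R : ℕ → ℍ[ℝ] := fun n => ∑' k, a ^ k * PowerSeries.coeff (n + k) η
  have hR : ∀ n, R n = PowerSeries.coeff n η + a * R (n + 1) := by
    intro n
    simp only [R]
    rw [(hsn n).tsum_eq_zero_add, ← tsum_mul_left]
    congr 1
    · simp
    · refine tsum_congr fun k => ?_
      rw [pow_succ', mul_assoc, add_right_comm, add_assoc]
  have hR0 : R 0 = 0 := by simpa [R, ev] using h0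
  refine ⟨PowerSeries.mk fun n => R (n + 1), ?_, ?_⟩
  · refine converges_of_bounded fun r hr0 hr1 => ?_
    -- The radius `s` dominates both `‖a‖`, to bound the tails, and `r`, to bound the final product.
    obtain ⟨s, hs, hs1⟩ := exists_between (max_lt ha hr1)
    obtain ⟨has, hrs⟩ := max_lt_iff.mp hs
    have hs0 : 0 < s := hr0.trans hrs
    have hsum := h s hs0.le hs1
    refine ⟨s⁻¹ * ∑' n, ‖PowerSeries.coeff n η‖ * s ^ n, fun n => ?_⟩
    rw [PowerSeries.coeff_mk]
    have hsum' : Summable fun k => ‖PowerSeries.coeff (n + 1 + k) η‖ * s ^ (n + 1 + k) :=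
      hsum.comp_injective (add_right_injective (n + 1))
    have h1 : ‖R (n + 1)‖ ≤ ∑' k, (s ^ (n + 1))⁻¹ *
        (‖PowerSeries.coeff (n + 1 + k) η‖ * s ^ (n + 1 + k)) := by
      refine tsum_of_norm_bounded (hsum'.mul_left _).hasSum fun k => ?_
      rw [norm_mul, norm_pow, pow_add s (n + 1), mul_left_comm _ (s ^ (n + 1)),
        inv_mul_cancel_left₀ (by positivity), mul_comm]
      gcongr
    rw [tsum_mul_left] at h1
    have h2 : ∑' k, ‖PowerSeries.coeff (n + 1 + k) η‖ * s ^ (n + 1 + k)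
        ≤ ∑' n, ‖PowerSeries.coeff n η‖ * s ^ n :=
      hsum'.tsum_le_tsum_of_inj (fun k => n + 1 + k) (add_right_injective _)
        (fun _ _ => by positivity) (fun _ => le_rfl) hsum
    calc ‖R (n + 1)‖ * r ^ n
        ≤ ((s ^ (n + 1))⁻¹ * ∑' n, ‖PowerSeries.coeff n η‖ * s ^ n) * s ^ n := by
          gcongr
          exact h1.trans (mul_le_mul_of_nonneg_left h2 (by positivity))
      _ = s⁻¹ * ∑' n, ‖PowerSeries.coeff n η‖ * s ^ n := by
          field_simp
          ring
  · ext1 n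
    rw [sub_mul, map_sub, PowerSeries.coeff_C_mul, PowerSeries.coeff_mk]
    have hn := hR n
    cases n with
    | zero =>
      rw [PowerSeries.coeff_zero_X_mul]
      rw [hR0] at hn
      rw [zero_sub]
      exact eq_neg_of_add_eq_zero_left hn.symm
    | succ n =>
      rw [PowerSeries.coeff_succ_X_mul, PowerSeries.coeff_mk, hn]
      simp

theorem ev_X_sub_mul_self {ρ : PowerSeries ℍ[ℝ]} (hρ : Converges ρ) {a : ℍ[ℝ]} (ha : ‖a‖ < 1) :
    ev ((X - C a) * ρ) a 1 = 0 := by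
  rw [ev_mul (converges_X.sub (converges_C a)) hρ ha, ev_sub converges_X (converges_C a) ha,
    ev_X, ev_C]
  simp [ev]

/-! ### The termwise derivative and zeros of higher order -/

/-- The termwise derivative. -/
def deriv (η : PowerSeries ℍ[ℝ]) : PowerSeries ℍ[ℝ] :=
  PowerSeries.mk fun n => ((n + 1 : ℕ) : ℍ[ℝ]) * PowerSeries.coeff (n + 1) η

theorem Converges.deriv {η : PowerSeries ℍ[ℝ]} (h : Converges η) : Converges (deriv η) := by
  refine converges_of_bounded fun r hr0 hr1 => ?_
  obtain ⟨s, hrs, hs1⟩ := exists_between hr1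
  have hs0 : 0 < s := hr0.trans hrs
  obtain ⟨B, hB⟩ := h.bounded hs0.le hs1
  have hq : r / s < 1 := (div_lt_one hs0).mpr hrs
  obtain ⟨K, hK⟩ := (tendsto_self_mul_const_pow_of_lt_one (by positivity) hq).bddAbove_range
  refine ⟨K * B * r⁻¹, fun n => ?_⟩
  have h1 := hK ⟨n + 1, rfl⟩
  have h2 := hB (n + 1)
  simp only at h1
  have hcoe : ‖((n + 1 : ℕ) : ℍ[ℝ])‖ = ((n + 1 : ℕ) : ℝ) := by
    rw [← Quaternion.coe_natCast, Quaternion.norm_coe, Real.norm_natCast]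
  rw [SliceRegular.deriv, PowerSeries.coeff_mk, norm_mul, hcoe]
  calc ((n + 1 : ℕ) : ℝ) * ‖PowerSeries.coeff (n + 1) η‖ * r ^ n
      = (((n + 1 : ℕ) : ℝ) * (r / s) ^ (n + 1)) *
          (‖PowerSeries.coeff (n + 1) η‖ * s ^ (n + 1)) * r⁻¹ := by
        rw [div_pow]; field_simp; ring
    _ ≤ K * B * r⁻¹ := by
        gcongr
        exact le_trans (by positivity) h1

theorem deriv_X_sub_mul (a : ℍ[ℝ]) (ρ : PowerSeries ℍ[ℝ]) :
    deriv ((X - C a) * ρ) = ρ + (X - C a) * deriv ρ := by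
  ext1 n
  rw [deriv, PowerSeries.coeff_mk, map_add, sub_mul, sub_mul, map_sub, map_sub,
    PowerSeries.coeff_C_mul, PowerSeries.coeff_C_mul, PowerSeries.coeff_succ_X_mul, deriv,
    PowerSeries.coeff_mk]
  have hc : ((n + 1 : ℕ) : ℍ[ℝ]) * a = a * (n + 1 : ℕ) := Nat.cast_commute _ _
  have hX : PowerSeries.coeff n
      (X * PowerSeries.mk fun n => ((n + 1 : ℕ) : ℍ[ℝ]) * PowerSeries.coeff (n + 1) ρ)
      = (n : ℍ[ℝ]) * PowerSeries.coeff n ρ := by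
    cases n with
    | zero => simp
    | succ n => rw [PowerSeries.coeff_succ_X_mul, PowerSeries.coeff_mk]
  rw [hX, mul_sub, ← mul_assoc, hc, mul_assoc]
  push_cast
  rw [add_mul, one_mul]
  abel

theorem deriv_add (η ψ : PowerSeries ℍ[ℝ]) : deriv (η + ψ) = deriv η + deriv ψ := by
  ext1 n
  simp [deriv, mul_add]

theorem Converges.iterate_deriv {η : PowerSeries ℍ[ℝ]} (h : Converges η) (k : ℕ) :
    Converges (SliceRegular.deriv^[k] η) := by
  induction k with
  | zero => exact h
  | succ k ih => rw [Function.iterate_succ_apply']; exact ih.deriv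

theorem iterate_deriv_X_sub_mul (a : ℍ[ℝ]) (ρ : PowerSeries ℍ[ℝ]) (k : ℕ) :
    deriv^[k + 1] ((X - C a) * ρ)
      = (k + 1) • deriv^[k] ρ + (X - C a) * deriv^[k + 1] ρ := by
  induction k with
  | zero => simp [deriv_X_sub_mul]
  | succ k ih =>
    have hsmul : ∀ m : ℕ, ∀ σ, deriv (m • σ) = m • deriv σ := by
      intro m σ
      induction m with
      | zero => ext1 n; simp [deriv]
      | succ m ihm => rw [succ_nsmul, deriv_add, ihm, succ_nsmul]
    rw [Function.iterate_succ_apply', ih, deriv_add, hsmul, deriv_X_sub_mul,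
      ← Function.iterate_succ_apply' deriv, ← Function.iterate_succ_apply' deriv,
      succ_nsmul _ (k + 1), add_assoc]

theorem ev_add {η ψ : PowerSeries ℍ[ℝ]} (h : Converges η) (h' : Converges ψ) {q : ℍ[ℝ]}
    (hq : ‖q‖ < 1) (w : ℍ[ℝ]) : ev (η + ψ) q w = ev η q w + ev ψ q w := by
  simp only [ev, map_add, mul_add]
  exact (h.summable hq w).tsum_add (h'.summable hq w)

theorem ev_nsmul (m : ℕ) (η : PowerSeries ℍ[ℝ]) (q w : ℍ[ℝ]) :
    ev (m • η) q w = (m : ℝ) • ev η q w := by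
  rw [ev, ev, ← tsum_const_smul'']
  refine tsum_congr fun n => ?_
  rw [map_nsmul, mul_smul_comm, Nat.cast_smul_eq_nsmul]

/-- In Leibniz' rule the term that keeps the left factor `X - a` vanishes at `a`. Vanishing
derivatives of the product therefore pass to the quotient with the order lowered by one. -/
theorem ev_iterate_deriv_X_sub_mul {ρ : PowerSeries ℍ[ℝ]} (hρ : Converges ρ) {a : ℍ[ℝ]}
    (ha : ‖a‖ < 1) (k : ℕ) : ev (deriv^[k + 1] ((X - C a) * ρ)) a 1
      = ((k + 1 : ℕ) : ℝ) • ev (deriv^[k] ρ) a 1 := by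
  have hc : Converges ((k + 1) • deriv^[k] ρ) := by
    intro r hr0 hr1
    refine ((hρ.iterate_deriv k r hr0 hr1).mul_left ((k + 1 : ℕ) : ℝ)).congr fun n => ?_
    rw [map_nsmul, ← Nat.cast_smul_eq_nsmul ℝ, norm_smul, Real.norm_natCast, mul_assoc]
  rw [iterate_deriv_X_sub_mul, ev_add hc
    ((converges_X.sub (converges_C a)).mul (hρ.iterate_deriv (k + 1))) ha,
    ev_X_sub_mul_self (hρ.iterate_deriv _) ha, add_zero, ev_nsmul]

/-- A power series vanishing at `a` to order `n` is divisible by the `n`-th power of `X - a`. -/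
theorem exists_eq_X_sub_pow_mul {a : ℍ[ℝ]} (ha : ‖a‖ < 1) (n : ℕ) {η : PowerSeries ℍ[ℝ]}
    (h : Converges η) (h0 : ∀ m < n, ev (deriv^[m] η) a 1 = 0) :
    ∃ ρ, Converges ρ ∧ η = (X - C a) ^ n * ρ ∧ ev (deriv^[n] η) a 1 = (n ! : ℝ) • ev ρ a 1 := by
  induction n generalizing η with
  | zero => exact ⟨η, h, by simp, by simp⟩
  | succ n ih =>
    obtain ⟨ρ, hρ, rfl⟩ := exists_eq_X_sub_mul h ha (h0 0 n.succ_pos)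
    obtain ⟨σ, hσ, hρσ, hn⟩ := ih hρ fun m hm => by
      have := h0 (m + 1) (by omega)
      rw [ev_iterate_deriv_X_sub_mul hρ ha] at this
      exact (smul_eq_zero.mp this).resolve_left (by positivity)
    refine ⟨σ, hσ, ?_, ?_⟩
    · rw [pow_succ', mul_assoc, ← hρσ]
    · rw [ev_iterate_deriv_X_sub_mul hρ ha, hn, smul_smul, Nat.factorial_succ, Nat.cast_mul]

/-! ### The Schwarz lemma -/

/-- Only the central `X` and the commuting constants `a` and `star a` occur. -/
theorem commute_X_sub_one_sub (a : ℍ[ℝ]) : Commute (X - C a) (1 - C (star a) * X) := by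
  have h1 : Commute (C a) (C (star a)) := by
    rw [Commute, SemiconjBy, ← map_mul, ← map_mul, Quaternion.self_mul_star,
      Quaternion.star_mul_self]
  have hX : ∀ σ : PowerSeries ℍ[ℝ], Commute X σ := fun σ => (PowerSeries.commute_X σ).symm
  refine (Commute.one_right _).sub_right (((hX _).sub_left h1).mul_right ((hX _).symm))

/-- For `‖a‖ < ‖q‖` the Sylvester equation `q * v - v * a = w` is solvable. -/
theorem exists_preimage_X_sub {a q : ℍ[ℝ]} (haq : ‖a‖ < ‖q‖) (w : ℍ[ℝ]) :
    ∃ v, q * v - v * a = w := by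
  let A : ℍ[ℝ] →ₗ[ℝ] ℍ[ℝ] := LinearMap.mulLeft ℝ q - LinearMap.mulRight ℝ a
  -- A kernel element satisfies `q * v = v * a`, which is impossible for norms unless `v = 0`;
  -- finite dimension then gives surjectivity.
  have hA : Function.Injective A := by
    refine (injective_iff_map_eq_zero A).mpr fun v hv => ?_
    have h1 : q * v = v * a := sub_eq_zero.mp hv
    have h2 := congrArg norm h1
    rw [norm_mul, norm_mul, mul_comm ‖v‖] at h2
    by_contra hv0
    exact haq.ne' (mul_right_cancel₀ (norm_ne_zero_iff.mpr hv0) h2)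
  obtain ⟨v, hv⟩ := LinearMap.injective_iff_surjective.mp hA w
  exact ⟨v, hv⟩

/-- The equation reads `q (v + w a̅) = w + v a`. For `|q| = 1` the cross terms would cancel and give
`|v| = |w|`. Inside the ball a multiple `1 - |q|²` of the cross term survives and is absorbed by
`2|w||v| ≤ |w|² + |v|²`. -/
theorem norm_sq_le_of_eq {a q v w : ℍ[ℝ]} (ha : ‖a‖ < 1) (hq1 : ‖q‖ < 1)
    (h : q * v - v * a = w - q * w * star a) :
    ‖v‖ ^ 2 * (2 * ‖q‖ ^ 2 - 1 - ‖a‖ ^ 2) ≤ ‖w‖ ^ 2 * (2 - ‖q‖ ^ 2 - ‖q‖ ^ 2 * ‖a‖ ^ 2) := by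
  have h1 : q * (v + w * star a) = w + v * a := by
    rw [mul_add, ← mul_assoc, ← sub_eq_sub_iff_add_eq_add]
    exact h
  have h2 := congrArg (fun x => ‖x‖ ^ 2) h1
  simp only [norm_mul, mul_pow] at h2
  rw [norm_sq_add_mul_star w v a, norm_sq_add_mul w v a] at h2
  have h3 : |inner ℝ w (v * a)| ≤ ‖w‖ * ‖v‖ := by
    refine (abs_real_inner_le_norm _ _).trans ?_
    rw [norm_mul]
    gcongr
    exact mul_le_of_le_one_right (norm_nonneg _) ha.le
  have h4 : 2 * inner ℝ w (v * a) ≤ ‖w‖ ^ 2 + ‖v‖ ^ 2 := by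
    nlinarith [le_abs_self (inner ℝ w (v * a)), sq_nonneg (‖w‖ - ‖v‖)]
  have h5 : ‖q‖ ^ 2 < 1 := pow_lt_one₀ (norm_nonneg _) hq1 two_ne_zero
  nlinarith [mul_le_mul_of_nonneg_right h4 (by linarith : 0 ≤ 1 - ‖q‖ ^ 2)]

/-- If `(q - a) * ρ` is contractive, so is `(1 - a̅ q) * ρ`. -/
theorem Contractive.replace_factor {a : ℍ[ℝ]} (ha : ‖a‖ < 1) {ρ : PowerSeries ℍ[ℝ]}
    (hρ : Converges ρ) (h : Contractive ((X - C a) * ρ)) :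
    Contractive ((1 - C (star a) * X) * ρ) := by
  have hl := converges_one.sub ((converges_C (star a)).mul converges_X)
  refine ⟨hl.mul hρ, fun q hq w => ?_⟩
  have hsphere : ∀ r : ℝ, ‖a‖ < r → 1 + ‖a‖ ^ 2 < 2 * r ^ 2 → r < 1 → ∀ p : ℍ[ℝ], ‖p‖ = r →
      ‖ev ((1 - C (star a) * X) * ρ) p w‖ ≤
        ‖w‖ * √((2 - r ^ 2 - r ^ 2 * ‖a‖ ^ 2) / (2 * r ^ 2 - 1 - ‖a‖ ^ 2)) := by
    intro r har har' hr1 p hp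
    have hp1 : ‖p‖ < 1 := hp ▸ hr1
    -- With this `v`, the factor `X - a` sends `v` to the weight that `1 - a̅ X` makes of `w`, so
    -- both products take the same value.
    obtain ⟨v, hv⟩ := exists_preimage_X_sub (hp ▸ har) (w - p * w * star a)
    have h1 : ev ((1 - C (star a) * X) * ρ) p w = ev ((X - C a) * ρ) p v := by
      rw [ev_mul hl hρ hp1, ev_mul (converges_X.sub (converges_C a)) hρ hp1,
        ev_sub converges_X (converges_C a) hp1, ev_X, ev_C, hv,
        ev_sub converges_one ((converges_C _).mul converges_X) hp1, ev_one,
        ev_mul (converges_C _) converges_X hp1, ev_C, ev_X, mul_assoc]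
    rw [h1]
    refine (h.2 p hp1 v).trans ?_
    have h2 := norm_sq_le_of_eq ha hp1 hv
    rw [hp] at h2
    have h3 : 0 < 2 * r ^ 2 - 1 - ‖a‖ ^ 2 := by linarith
    rw [← le_div_iff₀ h3, mul_div_assoc] at h2
    calc ‖v‖ = √(‖v‖ ^ 2) := (Real.sqrt_sq (norm_nonneg _)).symm
      _ ≤ √(‖w‖ ^ 2 * ((2 - r ^ 2 - r ^ 2 * ‖a‖ ^ 2) / (2 * r ^ 2 - 1 - ‖a‖ ^ 2))) :=
        Real.sqrt_le_sqrt h2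
      _ = _ := by rw [Real.sqrt_mul (sq_nonneg _), Real.sqrt_sq (norm_nonneg _)]
  -- At `r = 1` numerator and denominator are both `1 - |a|²`; the loss in the estimate disappears
  -- in the limit.
  have hlim : Filter.Tendsto
      (fun r : ℝ => ‖w‖ * √((2 - r ^ 2 - r ^ 2 * ‖a‖ ^ 2) / (2 * r ^ 2 - 1 - ‖a‖ ^ 2)))
      (nhdsWithin 1 (Set.Iio 1)) (nhds ‖w‖) := by
    have ha2 : ‖a‖ ^ 2 < 1 := pow_lt_one₀ (norm_nonneg _) ha two_ne_zero
    have hc : ContinuousAt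
        (fun r : ℝ => ‖w‖ * √((2 - r ^ 2 - r ^ 2 * ‖a‖ ^ 2) / (2 * r ^ 2 - 1 - ‖a‖ ^ 2))) 1 := by
      refine continuousAt_const.mul (ContinuousAt.sqrt (ContinuousAt.div ?_ ?_ ?_))
      · fun_prop
      · fun_prop
      · nlinarith
    have h1 : ‖w‖ * √((2 - (1 : ℝ) ^ 2 - 1 ^ 2 * ‖a‖ ^ 2) / (2 * 1 ^ 2 - 1 - ‖a‖ ^ 2)) = ‖w‖ := by
      rw [show (2 - (1 : ℝ) ^ 2 - 1 ^ 2 * ‖a‖ ^ 2) = 2 * 1 ^ 2 - 1 - ‖a‖ ^ 2 by ring,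
        div_self (by nlinarith), Real.sqrt_one, mul_one]
    have := hc.tendsto.mono_left (nhdsWithin_le_nhds (s := Set.Iio 1))
    rwa [h1] at this
  refine ge_of_tendsto hlim ?_
  have e1 : ∀ᶠ r in nhdsWithin (1 : ℝ) (Set.Iio 1), ‖a‖ < r :=
    nhdsWithin_le_nhds (lt_mem_nhds ha)
  have e2 : ∀ᶠ r in nhdsWithin (1 : ℝ) (Set.Iio 1), ‖q‖ < r :=
    nhdsWithin_le_nhds (lt_mem_nhds hq)
  have e3 : ∀ᶠ r in nhdsWithin (1 : ℝ) (Set.Iio 1), 1 + ‖a‖ ^ 2 < 2 * r ^ 2 := by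
    refine nhdsWithin_le_nhds (Filter.Tendsto.eventually_const_lt (v := 2 * 1 ^ 2) ?_ ?_)
    · nlinarith [pow_lt_one₀ (norm_nonneg a) ha two_ne_zero]
    · exact Continuous.tendsto (by fun_prop) 1
  filter_upwards [e1, e2, e3, self_mem_nhdsWithin] with r h1 h2 h3 h4
  exact (hl.mul hρ).norm_ev_le_of_sphere h4 (hsphere r h1 h3 h4) h2

/-- One factor is replaced at a time; the new one commutes past the remaining `X - a` and is
absorbed into `ρ`. -/
theorem Contractive.replace_factor_pow {a : ℍ[ℝ]} (ha : ‖a‖ < 1) (n : ℕ) {ρ : PowerSeries ℍ[ℝ]}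
    (hρ : Converges ρ) (h : Contractive ((X - C a) ^ n * ρ)) :
    Contractive ((1 - C (star a) * X) ^ n * ρ) := by
  have hl := converges_one.sub ((converges_C (star a)).mul converges_X)
  induction n generalizing ρ with
  | zero => simpa using h
  | succ n ih =>
    rw [pow_succ', mul_assoc] at h
    have h1 := h.replace_factor ha (((converges_X.sub (converges_C a)).pow n).mul hρ)
    rw [← mul_assoc, ← ((commute_X_sub_one_sub a).pow_left n).eq, mul_assoc] at h1
    rw [pow_succ, mul_assoc]
    exact ih (hl.mul hρ) h1

/-! ### The Cullen derivative of a power series -/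

theorem hasDerivAt_add_smul_pow {q v : ℍ[ℝ]} (h : Commute q v) (n : ℕ) (t : ℝ) :
    HasDerivAt (fun t : ℝ => (q + t • v) ^ n) ((n : ℝ) • ((q + t • v) ^ (n - 1) * v)) t := by
  have h1 : HasDerivAt (fun t : ℝ => q + t • v) v t := by
    simpa using ((hasDerivAt_id t).smul_const v).const_add q
  have hc : Commute (q + t • v) v := h.add_left ((Commute.refl v).smul_left t)
  induction n with
  | zero => simpa using hasDerivAt_const t (1 : ℍ[ℝ])
  | succ n ih =>
    simp only [pow_succ]
    refine (ih.mul h1).congr_deriv ?_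
    cases n with
    | zero => simp
    | succ n =>
      simp only [Nat.add_sub_cancel, smul_mul_assoc, mul_assoc, ← hc.eq]
      rw [← mul_assoc, ← pow_succ]
      push_cast
      simp only [add_smul, one_smul]

/-- The power rule needs a direction commuting with `q`; the directions `1` and `imUnit q` in the
Cullen derivative do. Termwise differentiation takes place on the convex set of `t` with `q + t v`
in a smaller ball. -/
theorem Represents.lineDeriv_eq {η : PowerSeries ℍ[ℝ]} {f : ℍ[ℝ] → ℍ[ℝ]} (h : Represents η f)
    {q v : ℍ[ℝ]} (hq : ‖q‖ < 1) (hv : Commute q v) :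
    lineDeriv ℝ f q v = v * ev (deriv η) q 1 := by
  obtain ⟨r, hqr, hr1⟩ := exists_between hq
  have hr0 : 0 ≤ r := (norm_nonneg q).trans hqr.le
  let U : Set ℝ := (fun t : ℝ => q + t • v) ⁻¹' Metric.ball 0 r
  have hU : IsOpen U := Metric.isOpen_ball.preimage (by fun_prop)
  have hUc : IsPreconnected U := by
    have hconv : Convex ℝ U := by
      intro s hs t ht a b ha hb hab
      have := convex_ball (0 : ℍ[ℝ]) r hs ht ha hb hab
      change q + _ • v ∈ Metric.ball 0 r
      convert this using 1
      simp only [smul_add, add_smul, smul_smul, smul_eq_mul]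
      rw [add_add_add_comm, ← add_smul a b, hab, one_smul]
    exact hconv.isPreconnected
  have h0 : (0 : ℝ) ∈ U := by simpa [U] using hqr
  have hnorm : ∀ t ∈ U, ‖q + t • v‖ < r := fun t ht => mem_ball_zero_iff.mp ht
  have hsum := h.converges.deriv r hr0 hr1
  have hd := hasDerivAt_tsum_of_isPreconnected
    (g := fun n t => (q + t • v) ^ n * PowerSeries.coeff n η)
    (g' := fun n t => (n : ℝ) • ((q + t • v) ^ (n - 1) * v) * PowerSeries.coeff n η)
    (u := fun n => ‖v‖ * (n * ‖PowerSeries.coeff n η‖ * r ^ (n - 1)))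
    ((summable_nat_add_iff 1).mp ((hsum.mul_left ‖v‖).congr fun n => by
      simp only [deriv, PowerSeries.coeff_mk, norm_mul, Nat.add_sub_cancel]
      rw [← Quaternion.coe_natCast (n + 1), Quaternion.norm_coe, Real.norm_natCast])) hU hUc
    (fun n t _ => (hasDerivAt_add_smul_pow hv n t).mul_const _)
    (fun n t ht => by
      rw [norm_mul, norm_smul, norm_mul, norm_pow, Real.norm_natCast]
      have := (hnorm t ht).le
      calc n * (‖q + t • v‖ ^ (n - 1) * ‖v‖) * ‖PowerSeries.coeff n η‖
          ≤ n * (r ^ (n - 1) * ‖v‖) * ‖PowerSeries.coeff n η‖ := by gcongr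
        _ = _ := by ring)
    h0 (by simpa using h.converges.summable hq 1) h0
  have hev : (fun t : ℝ => f (q + t • v)) =ᶠ[nhds 0]
      fun t => ∑' n, (q + t • v) ^ n * PowerSeries.coeff n η := by
    filter_upwards [hU.mem_nhds h0] with t ht
    exact ((h _ (mem_unitBall.mpr ((hnorm t ht).trans hr1))).tsum_eq).symm
  have hterm : ∀ n : ℕ, ((n + 1 : ℕ) : ℝ) • (q ^ (n + 1 - 1) * v) * PowerSeries.coeff (n + 1) η
      = v * (q ^ n * 1 * PowerSeries.coeff n (deriv η)) := by
    intro n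
    rw [deriv, PowerSeries.coeff_mk, Nat.add_sub_cancel, mul_one, (hv.pow_left n).eq,
      ← Quaternion.coe_natCast (n + 1), Quaternion.coe_mul_eq_smul, mul_smul_comm, mul_smul_comm,
      smul_mul_assoc, mul_assoc]
  -- The truncated exponent `n - 1` is harmless at `n = 0`, where the factor `n` kills the term.
  have hs : Summable fun n : ℕ => (n : ℝ) • (q ^ (n - 1) * v) * PowerSeries.coeff n η :=
    (summable_nat_add_iff 1).mp
      (((h.converges.deriv.summable hq 1).mul_left v).congr fun n => (hterm n).symm)
  rw [lineDeriv, hev.deriv_eq, hd.deriv]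
  simp only [zero_smul, add_zero]
  rw [hs.tsum_eq_zero_add, Nat.cast_zero, zero_smul, zero_mul, zero_add, ev, ← tsum_mul_left]
  exact tsum_congr hterm

/-- The line derivatives along `1` and `I` are `η'(q)` and `I η'(q)`; since `-I I = 1`, the Cullen
derivative is their common value `η'(q)`. -/
theorem Represents.cullenDeriv {η : PowerSeries ℍ[ℝ]} {f : ℍ[ℝ] → ℍ[ℝ]} (h : Represents η f) :
    Represents (deriv η) (cullenDeriv f) := by
  refine h.converges.deriv.represents.congr fun q hq => ?_
  have hq' := mem_unitBall.mp hq
  have hc : Commute q (imUnit q) := by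
    conv_lhs => rw [← eq_add_smul_imUnit q]
    exact (Quaternion.coe_commute _ _).add_left ((Commute.refl _).smul_left _)
  rw [SliceRegular.cullenDeriv, h.lineDeriv_eq hq' (Commute.one_right q), h.lineDeriv_eq hq' hc,
    one_mul, ← mul_assoc, ← sq, imUnit_sq, neg_one_mul, sub_neg_eq_add, ← two_smul ℝ, smul_smul]
  norm_num

theorem Represents.iterate_cullenDeriv {η : PowerSeries ℍ[ℝ]} {f : ℍ[ℝ] → ℍ[ℝ]}
    (h : Represents η f) (n : ℕ) :
    Represents (SliceRegular.deriv^[n] η) (SliceRegular.cullenDeriv^[n] f) := by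
  induction n with
  | zero => exact h
  | succ n ih =>
    rw [Function.iterate_succ_apply', Function.iterate_succ_apply']
    exact ih.cullenDeriv

theorem iterate_deriv_sub_C (η : PowerSeries ℍ[ℝ]) (a : ℍ[ℝ]) {m : ℕ} (hm : 1 ≤ m) :
    deriv^[m] (η - C a) = deriv^[m] η := by
  obtain ⟨m, rfl⟩ := Nat.exists_eq_add_of_le' hm
  rw [Function.iterate_succ_apply, Function.iterate_succ_apply]
  congr 1
  ext1 n
  simp [deriv]

/-- At the point `a` each factor sends a real weight `w` to `w - a w a̅ = (1 - |a|²) w`, which is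
again real, so the step can be repeated. -/
theorem ev_one_sub_pow_self {a : ℍ[ℝ]} (ha : ‖a‖ < 1) (n : ℕ) (w : ℝ) :
    ev ((1 - C (star a) * X) ^ n) a (w : ℍ[ℝ]) = (((1 - ‖a‖ ^ 2) ^ n * w : ℝ) : ℍ[ℝ]) := by
  have hX := (converges_C (star a)).mul converges_X
  have hl := converges_one.sub hX
  induction n with
  | zero => simp [ev_one]
  | succ n ih =>
    rw [pow_succ, ev_mul (hl.pow n) hl ha, ih, ev_sub converges_one hX ha, ev_one,
      ev_mul (converges_C _) converges_X ha, ev_C, ev_X, ← mul_assoc, ← Quaternion.coe_commutes,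
      mul_assoc, Quaternion.self_mul_star, Quaternion.normSq_eq_norm_mul_self,
      ← Quaternion.coe_mul, ← Quaternion.coe_sub]
    congr 1
    ring

end SliceRegular

end

/-! ### The theorem -/

theorem mainTheorem6 (f : ℍ[ℝ] → ℍ[ℝ])
    (hf : SliceRegular.IsRegularOn f SliceRegular.unitBall)
    (hmaps : Set.MapsTo f SliceRegular.unitBall SliceRegular.unitBall)
    (q₀ : ℍ[ℝ]) (hq₀ : q₀ ∈ SliceRegular.unitBall) (n : ℕ) (hn : 1 ≤ n)
    (hvanish : ∀ m : ℕ, 1 ≤ m → m ≤ n - 1 → (SliceRegular.cullenDeriv^[m] f) q₀ = 0) :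
    (∀ q ∈ SliceRegular.unitBall,
      SliceRegular.symm (SliceRegular.oneSubStar (f q₀) f) q ≠ 0) ∧
    (∀ q ∈ SliceRegular.unitBall,
      ‖SliceRegular.starDiv (fun p => f p - f q₀) (SliceRegular.oneSubStar (f q₀) f) q‖ ≤
        ‖SliceRegular.starDiv (SliceRegular.starPow (fun p => p - q₀) n)
          (SliceRegular.starPow (SliceRegular.oneSubStar q₀ (fun p => p)) n) q‖) ∧
    ‖SliceRegular.starDiv (SliceRegular.cullenDeriv^[n] f)
        (SliceRegular.oneSubStar (f q₀) f) q₀‖ ≤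
      (n ! : ℝ) / (1 - ‖q₀‖ ^ 2) ^ n := by
  open SliceRegular PowerSeries in
  obtain ⟨η, hη⟩ := hf.exists_represents
  have hηc := hη.contractive hmaps
  set a := f q₀ with ha_def
  have ha : ‖a‖ < 1 := mem_unitBall.mp (hmaps hq₀)
  have hq0 : ‖q₀‖ < 1 := mem_unitBall.mp hq₀
  obtain ⟨χ, hχ, hχl, hχr⟩ := hηc.exists_inverse ha
  obtain ⟨β, hβ, hβl, hβr⟩ := contractive_X.exists_inverse hq0
  have hψ := represents_oneSubStar hη a
  have hηa : Represents (η - C a) (fun p => f p - a) := hη.sub (represents_const a)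
  have hXq := converges_X.sub (converges_C q₀)
  have hlin : Converges (1 - C (star q₀) * X) :=
    converges_one.sub ((converges_C (star q₀)).mul converges_X)
  obtain ⟨ρ, hρ, hηρ, hder⟩ := exists_eq_X_sub_pow_mul hq0 n hηa.converges (fun m hm => by
    rcases Nat.eq_zero_or_pos m with rfl | hm0
    · rw [Function.iterate_zero_apply, hηa.ev_eq hq₀, sub_self]
    · rw [iterate_deriv_sub_C η a hm0, (hη.iterate_cullenDeriv m).ev_eq hq₀]
      exact hvanish m hm0 (by omega))
  rw [iterate_deriv_sub_C η a hn] at hder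
  have hcontr := hηc.schwarzPick ha hχ hχl
  rw [hηρ, mul_assoc] at hcontr
  have hκ := hcontr.replace_factor_pow hq0 n (hρ.mul hχ)
  refine ⟨fun q hq => hψ.symm_ne_zero hχ hχr hq, fun q hq => ?_, ?_⟩
  · have hq' := mem_unitBall.mp hq
    have hcomm : Commute β (1 - C (star q₀) * X) := by rw [Commute, SemiconjBy, hβl, hβr]
    have hβn : β ^ n * (1 - C (star q₀) * X) ^ n = 1 := by rw [← hcomm.mul_pow, hβl, one_pow]
    have hβn' : (1 - C (star q₀) * X) ^ n * β ^ n = 1 := by rw [← hcomm.symm.mul_pow, hβr, one_pow]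
    have hpow : Represents ((X - C q₀) ^ n) (starPow (fun p => p - q₀) n) :=
      (represents_id.sub (represents_const q₀)).starPow n
    have hden : Represents ((1 - C (star q₀) * X) ^ n) (starPow (oneSubStar q₀ (fun p => p)) n) :=
      (represents_oneSubStar represents_id q₀).starPow n
    rw [hηa.starDiv_eq hψ hχ hχl hχr hq, hpow.starDiv_eq hden (hβ.pow n) hβn hβn' hq]
    -- Inserting `β ^ n * (1 - q̅₀ X) ^ n = 1` exhibits the left quotient as the right one followed
    -- by a contractive series, which acts on the value of the right one as its weight.
    have hfac : (η - C a) * χ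
        = (X - C q₀) ^ n * β ^ n * ((1 - C (star q₀) * X) ^ n * (ρ * χ)) := by
      rw [hηρ, mul_assoc ((X - C q₀) ^ n) (β ^ n), ← mul_assoc (β ^ n), hβn, one_mul, mul_assoc]
    rw [hfac, ev_mul ((hXq.pow n).mul (hβ.pow n)) hκ.1 hq']
    exact hκ.2 q hq' _
  · have hpos : 0 < (1 - ‖q₀‖ ^ 2) ^ n :=
      pow_pos (sub_pos.mpr (pow_lt_one₀ (norm_nonneg _) hq0 two_ne_zero)) n
    rw [(hη.iterate_cullenDeriv n).starDiv_eq hψ hχ hχl hχr hq₀,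
      ev_mul (hη.iterate_cullenDeriv n).converges hχ hq0, hder, ev_smul_right,
      ← ev_mul hρ hχ hq0, norm_smul, Real.norm_natCast, div_eq_mul_inv]
    refine mul_le_mul_of_nonneg_left ?_ (Nat.cast_nonneg _)
    -- At `q₀` with weight one, the contractive series is the real number `(1 - |q₀|²)ⁿ` times the
    -- value of `ρ * χ`, and this value times `n!` is the quantity to be bounded.
    have h1 := hκ.2 q₀ hq0 ((1 : ℝ) : ℍ[ℝ])
    rw [ev_mul (hlin.pow n) (hρ.mul hχ) hq0, ev_one_sub_pow_self hq0, mul_one,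
      ← mul_one (((1 - ‖q₀‖ ^ 2) ^ n : ℝ) : ℍ[ℝ]), Quaternion.coe_mul_eq_smul, ev_smul_right,
      norm_smul, Real.norm_of_nonneg hpos.le, Quaternion.coe_one, norm_one] at h1
    rw [← one_div]
    exact (le_div_iff₀' hpos).mpr h1
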